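/- Let $d\ge 1$ be an integer and let $\mathcal F$ denote the unitary Fourier transform on $L^2(\mathbb R^d)$ (complex-valued functions), normalized by $\mathcal F f(\xi)=(2\pi)^{-d/2}\int_{\mathbb R^d}e^{-i\langle \xi,y\rangle}f(y)\,dy$. For $r>0$ let $\mathbf B^d(0,r)=\{x\in\mathbb R^d:\|x\|\le r\}$, where $\|\cdot\|$ is the Euclidean norm, and put $\mathbf B^d=\mathbf B^d(0,1)$. For $c>0$ define operators on $L^2(\mathbb R^d)$ by $$D_{\mathbf B^d}f=\chi_{\mathbf B^d}f,\qquad B_cf=\mathcal F^{-1}\big(\chi_{\mathbf B^d(0,c)}\,\mathcal F f\big),\qquad \mathcal Q_c=D_{\mathbf B^d}\,B_c\,D_{\mathbf B^d}.$$ For $0<\delta<1$ let $M_c(\delta)$ be the number of eigenvalues of $\mathcal Q_c$, counted with multiplicity, that are at least $\delta$. Then $M_c(\delta)$ is finite for every $c>0$ and, for every fixed $d\ge1$ and $\delta\in(0,1)$, $$M_c(\delta)=\frac{c^d}{2^d\,\Gamma\!\left(\frac d2+1\right)^2}+o(c^d)\qquad\text{as } c\to\infty .$$ -/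

import Mathlib

open MeasureTheory Filter Asymptotics
open scoped FourierTransform ENNReal

noncomputable section

namespace BallProlate

/-- Euclidean space `ℝ^d`. -/
abbrev E (d : ℕ) : Type := EuclideanSpace ℝ (Fin d)

/-- The complex Hilbert space `L²(ℝ^d)`. -/
abbrev L2 (d : ℕ) : Type := Lp (α := E d) ℂ 2 (volume : Measure (E d))

theorem memLp_comp_smul {d : ℕ} {r : ℝ} (hr : r ≠ 0) {g : E d → ℂ} (hg : MemLp g 2 volume) :
    MemLp (fun x => g (r • x)) 2 volume := by
  have h : MemLp g 2 (Measure.map (fun x : E d => r • x) volume) := by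
    rw [Measure.map_addHaar_smul volume hr]
    exact hg.smul_measure ENNReal.ofReal_ne_top
  exact h.comp_of_map (by fun_prop)

theorem ae_comp_smul {d : ℕ} {r : ℝ} (hr : r ≠ 0) {p : E d → Prop}
    (hp : ∀ᵐ x : E d, p x) : ∀ᵐ x : E d, p (r • x) :=
  (Measure.quasiMeasurePreserving_smul volume hr).ae hp

theorem memLp_dilation {d : ℕ} {r : ℝ} (hr : r ≠ 0) (g : L2 d) :
    MemLp (fun x => ((Real.sqrt (|r| ^ d) : ℝ) : ℂ) * g (r • x)) 2 volume :=
  (memLp_comp_smul hr (Lp.memLp g)).const_mul _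

/-- The unitary dilation `g ↦ |r|^{d/2} g(r ·)` of `L²(ℝ^d)`, as a map (for `r ≠ 0`). -/
def dilationFun {d : ℕ} {r : ℝ} (hr : r ≠ 0) (g : L2 d) : L2 d :=
  (memLp_dilation hr g).toLp (fun x => ((Real.sqrt (|r| ^ d) : ℝ) : ℂ) * g (r • x))

theorem coeFn_dilationFun {d : ℕ} {r : ℝ} (hr : r ≠ 0) (g : L2 d) :
    dilationFun hr g =ᵐ[volume] fun x => ((Real.sqrt (|r| ^ d) : ℝ) : ℂ) * g (r • x) :=
  MemLp.coeFn_toLp _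

theorem dilationFun_dilationFun {d : ℕ} {r s : ℝ} (hr : r ≠ 0) (hs : s ≠ 0) (hrs : r * s = 1)
    (g : L2 d) : dilationFun hr (dilationFun hs g) = g := by
  apply Lp.ext
  filter_upwards [coeFn_dilationFun hr (dilationFun hs g),
    ae_comp_smul hr (coeFn_dilationFun hs g)] with x h1 h2
  have hk : Real.sqrt (|r| ^ d) * Real.sqrt (|s| ^ d) = 1 := by
    rw [← Real.sqrt_mul (by positivity), ← mul_pow, ← abs_mul, hrs]; simp
  rw [h1, h2, smul_smul, mul_comm s r, hrs, one_smul, ← mul_assoc, ← Complex.ofReal_mul, hk]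
  simp

theorem norm_dilationFun {d : ℕ} {r : ℝ} (hr : r ≠ 0) (g : L2 d) : ‖dilationFun hr g‖ = ‖g‖ := by
  have key : ∀ f : L2 d, ‖f‖ ^ 2 = ∫ x, ‖f x‖ ^ 2 := by
    intro f
    have h := L2.inner_def (𝕜 := ℂ) f f
    rw [inner_self_eq_norm_sq_to_K] at h
    have h2 : (∫ x, inner ℂ (f x) (f x)) = ((∫ x, ‖f x‖ ^ 2 : ℝ) : ℂ) := by
      rw [← integral_complex_ofReal]
      refine integral_congr_ae (Eventually.of_forall fun x => ?_)
      simp only [inner_self_eq_norm_sq_to_K]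
      push_cast
      rfl
    rw [h2] at h
    exact Complex.ofReal_injective (by simpa using h)
  have hsq : ‖dilationFun hr g‖ ^ 2 = ‖g‖ ^ 2 := by
    rw [key, key]
    have h1 : (∫ x, ‖dilationFun hr g x‖ ^ 2) = ∫ x : E d, |r| ^ d * ‖g (r • x)‖ ^ 2 := by
      refine integral_congr_ae ?_
      filter_upwards [coeFn_dilationFun hr g] with x hx
      rw [hx, norm_mul, mul_pow, Complex.norm_real, Real.norm_eq_abs, sq_abs,
        Real.sq_sqrt (by positivity)]
    rw [h1, integral_const_mul, Measure.integral_comp_smul volume (fun y => ‖g y‖ ^ 2) r]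
    have : |r| ^ d ≠ 0 := pow_ne_zero _ (abs_ne_zero.2 hr)
    simp only [finrank_euclideanSpace_fin, abs_inv, abs_pow, smul_eq_mul]
    rw [← mul_assoc, mul_inv_cancel₀ this, one_mul]
  exact (pow_left_inj₀ (norm_nonneg _) (norm_nonneg _) two_ne_zero).1 hsq

/-- The unitary dilation `g ↦ |r|^{d/2} g(r ·)` of `L²(ℝ^d)` (for `r ≠ 0`). -/
def dilation {d : ℕ} (r : ℝ) (hr : r ≠ 0) : L2 d ≃ₗᵢ[ℂ] L2 d where
  toFun := dilationFun hr
  invFun := dilationFun (inv_ne_zero hr)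
  left_inv := dilationFun_dilationFun _ _ (inv_mul_cancel₀ hr)
  right_inv := dilationFun_dilationFun _ _ (mul_inv_cancel₀ hr)
  map_add' f g := by
    apply Lp.ext
    filter_upwards [coeFn_dilationFun hr (f + g), Lp.coeFn_add (dilationFun hr f)
      (dilationFun hr g), coeFn_dilationFun hr f, coeFn_dilationFun hr g,
      ae_comp_smul hr (Lp.coeFn_add f g)] with x h1 h2 h3 h4 h5
    rw [h1, h2, Pi.add_apply, h3, h4, h5, Pi.add_apply, mul_add]
  map_smul' a f := by
    apply Lp.ext
    filter_upwards [coeFn_dilationFun hr (a • f), Lp.coeFn_smul a (dilationFun hr f),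
      coeFn_dilationFun hr f, ae_comp_smul hr (Lp.coeFn_smul a f)] with x h1 h2 h3 h4
    simp only [RingHom.id_apply]
    rw [h1, h2, Pi.smul_apply, h3, h4, Pi.smul_apply, smul_eq_mul, smul_eq_mul, mul_left_comm]
  norm_map' := norm_dilationFun hr

/-- The unitary Fourier transform on `L²(ℝ^d)` with the normalization
`(ℱ f)(ξ) = (2π)^{-d/2} ∫ e^{-i⟨ξ, y⟩} f(y) dy`.
Mathlib's transform `𝓕` uses the kernel `e^{-2πi⟨ξ, y⟩}`, so that
`(ℱ f)(ξ) = (2π)^{-d/2} (𝓕 f)(ξ / (2π))`. -/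
def fourier (d : ℕ) : L2 d ≃ₗᵢ[ℂ] L2 d :=
  (Lp.fourierTransformₗᵢ (E d) ℂ).trans
    (dilation (2 * Real.pi)⁻¹ (inv_ne_zero Real.two_pi_pos.ne'))

/-- Multiplication by the indicator function of `U` on `L²(ℝ^d)`, as a map. -/
def cutoffFun {d : ℕ} {U : Set (E d)} (hU : MeasurableSet U) (f : L2 d) : L2 d :=
  ((Lp.memLp f).indicator hU).toLp (U.indicator f)

theorem coeFn_cutoffFun {d : ℕ} {U : Set (E d)} (hU : MeasurableSet U) (f : L2 d) :
    cutoffFun hU f =ᵐ[volume] U.indicator f :=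
  MemLp.coeFn_toLp _

theorem cutoffFun_add {d : ℕ} {U : Set (E d)} (hU : MeasurableSet U) (f g : L2 d) :
    cutoffFun hU (f + g) = cutoffFun hU f + cutoffFun hU g := by
  apply Lp.ext
  filter_upwards [coeFn_cutoffFun hU (f + g), Lp.coeFn_add (cutoffFun hU f) (cutoffFun hU g),
    coeFn_cutoffFun hU f, coeFn_cutoffFun hU g, Lp.coeFn_add f g] with x h1 h2 h3 h4 h5
  rw [h1, h2, Pi.add_apply, h3, h4]
  by_cases hx : x ∈ U
  · rw [Set.indicator_of_mem hx, Set.indicator_of_mem hx, Set.indicator_of_mem hx, h5,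
      Pi.add_apply]
  · rw [Set.indicator_of_notMem hx, Set.indicator_of_notMem hx, Set.indicator_of_notMem hx,
      add_zero]

theorem cutoffFun_smul {d : ℕ} {U : Set (E d)} (hU : MeasurableSet U) (a : ℂ) (f : L2 d) :
    cutoffFun hU (a • f) = a • cutoffFun hU f := by
  apply Lp.ext
  filter_upwards [coeFn_cutoffFun hU (a • f), Lp.coeFn_smul a (cutoffFun hU f),
    coeFn_cutoffFun hU f, Lp.coeFn_smul a f] with x h1 h2 h3 h4
  rw [h1, h2, Pi.smul_apply, h3]
  by_cases hx : x ∈ U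
  · rw [Set.indicator_of_mem hx, Set.indicator_of_mem hx, h4, Pi.smul_apply]
  · rw [Set.indicator_of_notMem hx, Set.indicator_of_notMem hx, smul_zero]

theorem norm_cutoffFun_le {d : ℕ} {U : Set (E d)} (hU : MeasurableSet U) (f : L2 d) :
    ‖cutoffFun hU f‖ ≤ 1 * ‖f‖ := by
  rw [one_mul]
  refine Lp.norm_le_norm_of_ae_le ?_
  filter_upwards [coeFn_cutoffFun hU f] with x h1
  rw [h1]
  exact norm_indicator_le_norm_self _ _

/-- The operator `D_U` on `L²(ℝ^d)`: multiplication by the indicator function of `U`. -/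
def cutoff {d : ℕ} (U : Set (E d)) (hU : MeasurableSet U) : L2 d →L[ℂ] L2 d :=
  LinearMap.mkContinuous
    { toFun := cutoffFun hU
      map_add' := cutoffFun_add hU
      map_smul' := cutoffFun_smul hU } 1 (norm_cutoffFun_le hU)

/-- Multiplication by the indicator function of the closed ball of radius `r` about `0`. -/
def ballCutoff (d : ℕ) (r : ℝ) : L2 d →L[ℂ] L2 d :=
  cutoff (Metric.closedBall (0 : E d) r) Metric.isClosed_closedBall.measurableSet

/-- The band-limiting operator `B_c = ℱ⁻¹ χ_{B(0,c)} ℱ`. -/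
def bandLimit (d : ℕ) (c : ℝ) : L2 d →L[ℂ] L2 d :=
  ((fourier d).symm.toContinuousLinearEquiv : L2 d →L[ℂ] L2 d) ∘L
    ballCutoff d c ∘L ((fourier d).toContinuousLinearEquiv : L2 d →L[ℂ] L2 d)

/-- The time-and-band-limiting operator `Q_c = D_B B_c D_B`, `B` the closed unit ball. -/
def Q (d : ℕ) (c : ℝ) : L2 d →L[ℂ] L2 d :=
  ballCutoff d 1 ∘L bandLimit d c ∘L ballCutoff d 1

/-- The number `M_c(δ)` of eigenvalues `μ ≥ δ` of `Q_c`, counted with multiplicity: the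
(possibly infinite) sum of the dimensions of the eigenspaces over all real `μ ≥ δ`. -/
def eigenvalueCount (d : ℕ) (c δ : ℝ) : Cardinal :=
  Cardinal.sum fun μ : Set.Ici δ =>
    Module.rank ℂ (Module.End.eigenspace (Q d c : L2 d →ₗ[ℂ] L2 d) ((μ : ℝ) : ℂ))

end BallProlate

end

noncomputable section

namespace BallProlate

/-! Put `T = B_c D_B` and `R = c / (2π)`. Since `B_c` is an orthogonal projection, `Q_c = T* T` is
positive. `T` is an integral operator with kernel `K_R (x - y)` on `y ∈ B`, where `K_R` is the
inverse Fourier transform of the indicator of the ball of radius `R`. It is Hilbert–Schmidt, so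
`Q_c` is compact and has an orthonormal eigenbasis with eigenvalues `λ_i = ‖T b_i‖² ∈ [0, 1]`.

Two sums control the count. By Plancherel, `∑ λ_i` is the squared Hilbert–Schmidt norm of `T`,
namely `|B| |B(0, R)|`, which is the claimed main term. Splitting `‖T b_i‖²` into its parts inside
and outside `B` shows that `∑ λ_i (1 - λ_i)` is the squared Hilbert–Schmidt norm of `(1 - D_B) B_c
D_B` (`leakage`). After rescaling, dominated convergence makes this `o(R^d)`: the translates of `B`
by `w / R` tend to `B` (`tendsto_leakage_div`).

The quantity `λ (1 - λ)` dominates, up to a constant depending on `δ`, the distance from `λ` to the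
indicator of `λ ≥ δ`. Hence the count differs from `∑ λ_i` by `o(c^d)` (`abs_ncard_sub_tsum_le`,
`eigenvalueCount_bound`). -/

/-! ### The Fourier transform on L¹ ∩ L² and its normalization -/

theorem integral_smul_fourierInv_eq_flip {d : ℕ} {φ g : E d → ℂ} (hφ : Integrable φ)
    (hg : Integrable g) : ∫ x, 𝓕⁻ φ x • g x = ∫ x, φ x • 𝓕⁻ g x := by
  have h := VectorFourier.integral_fourierIntegral_smul_eq_flip (μ := volume) (ν := volume)
    (e := Real.fourierChar) (L := -innerₗ (E d)) Real.continuous_fourierChar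
    (by
      have : Continuous fun p : E d × E d => -(inner ℝ p.1 p.2) := by fun_prop
      exact this) hφ hg
  have hflip : (-innerₗ (E d)).flip = -innerₗ (E d) := by
    ext x y
    simp [real_inner_comm]
  rw [hflip] at h
  exact h

/-- On `L¹ ∩ L²` the inverse Fourier transform of `L²` is given by the Fourier integral. -/
theorem coeFn_fourierInv_toLp {d : ℕ} {g : E d → ℂ} (hg : MemLp g 2 volume)
    (hg1 : Integrable g) :
    ((𝓕⁻ (hg.toLp g) : L2 d) : E d → ℂ) =ᵐ[volume] 𝓕⁻ g := by
  have hcont : Continuous (𝓕⁻ g) := by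
    rw [← Real.Lp.fourierTransformInv_toLp (memLp_one_iff_integrable.2 hg1)]
    exact BoundedContinuousFunction.continuous _
  -- Both sides are locally integrable, so testing against smooth compactly supported `φ` suffices;
  -- the L² transform agrees with the distributional one, which moves `𝓕⁻` onto `φ`.
  refine ae_eq_of_integral_contDiff_smul_eq ((Lp.memLp _).locallyIntegrable one_le_two)
    hcont.locallyIntegrable fun φ hφ hφc => ?_
  have h1 : HasCompactSupport (fun x => (φ x : ℂ)) := hφc.comp_left Complex.ofReal_zero
  have h2 : ContDiff ℝ (⊤ : ℕ∞) (fun x => (φ x : ℂ)) := Complex.ofRealCLM.contDiff.comp hφ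
  have h := DFunLike.congr_fun (Lp.fourierInv_toTemperedDistribution_eq (hg.toLp g))
    (h1.toSchwartzMap h2)
  rw [TemperedDistribution.fourierInv_apply, Lp.toTemperedDistribution_apply,
    Lp.toTemperedDistribution_apply, SchwartzMap.fourierInv_coe] at h
  have hcoe : ⇑(h1.toSchwartzMap h2) = fun x => (φ x : ℂ) := rfl
  have h3 : ∫ x, 𝓕⁻ (fun x => (φ x : ℂ)) x • (hg.toLp g) x
      = ∫ x, 𝓕⁻ (fun x => (φ x : ℂ)) x • g x := by
    refine integral_congr_ae ?_
    filter_upwards [hg.coeFn_toLp] with x hx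
    rw [hx]
  have hint : Integrable fun x => (φ x : ℂ) := (h1.toSchwartzMap h2).integrable
  rw [hcoe, h3, integral_smul_fourierInv_eq_flip hint hg1] at h
  simpa using h.symm

theorem dilation_symm_apply {d : ℕ} {r : ℝ} (hr : r ≠ 0) (g : L2 d) :
    (dilation r hr).symm g = dilationFun (inv_ne_zero hr) g := rfl

theorem coeFn_ballCutoff {d : ℕ} (r : ℝ) (f : L2 d) :
    ballCutoff d r f =ᵐ[volume] (Metric.closedBall (0 : E d) r).indicator f :=
  coeFn_cutoffFun Metric.isClosed_closedBall.measurableSet f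

/-- With `r = (2π)⁻¹` this absorbs the dilation in `fourier`, so that only `𝓕` and the radius `c /
(2π)` remain. -/
theorem dilation_symm_ballCutoff_dilation {d : ℕ} {r : ℝ} (hr : 0 < r) (c : ℝ) (f : L2 d) :
    (dilation r hr.ne').symm (ballCutoff d c (dilation r hr.ne' f)) = ballCutoff d (r * c) f := by
  rw [dilation_symm_apply]
  apply Lp.ext
  have hr' := inv_ne_zero hr.ne'
  have hself : dilationFun hr' (dilation r hr.ne' f) = f :=
    dilationFun_dilationFun hr' hr.ne' (inv_mul_cancel₀ hr.ne') f
  -- Writing `f` as a dilate of its own dilate gives it the same scalar factor as in `h1`, so the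
  -- factor is never computed.
  have h0 := coeFn_dilationFun hr' (dilation r hr.ne' f)
  rw [hself] at h0
  filter_upwards [coeFn_dilationFun hr' (ballCutoff d c (dilation r hr.ne' f)),
    ae_comp_smul hr' (coeFn_ballCutoff c (dilation r hr.ne' f)),
    coeFn_ballCutoff (r * c) f, h0] with x h1 h2 h3 h4
  rw [h1, h2, h3]
  by_cases hx : x ∈ Metric.closedBall (0 : E d) (r * c)
  · rw [Set.indicator_of_mem hx, Set.indicator_of_mem, h4]
    rw [mem_closedBall_zero_iff] at hx ⊢
    rw [norm_smul, Real.norm_eq_abs, abs_of_pos (inv_pos.2 hr), inv_mul_le_iff₀ hr]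
    exact hx
  · rw [Set.indicator_of_notMem hx, Set.indicator_of_notMem, mul_zero]
    rw [mem_closedBall_zero_iff] at hx ⊢
    rw [norm_smul, Real.norm_eq_abs, abs_of_pos (inv_pos.2 hr), inv_mul_le_iff₀ hr]
    exact hx

theorem bandLimit_apply (d : ℕ) (c : ℝ) (f : L2 d) :
    bandLimit d c f = 𝓕⁻ (ballCutoff d ((2 * Real.pi)⁻¹ * c) (𝓕 f)) := by
  rw [← dilation_symm_ballCutoff_dilation (inv_pos.2 Real.two_pi_pos) c]
  rfl

/-! ### The band kernel and plane waves -/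

/-- The inverse Fourier transform of the indicator function of the ball of radius `R`. -/
def bandKernel (d : ℕ) (R : ℝ) : E d → ℂ :=
  𝓕⁻ ((Metric.closedBall (0 : E d) R).indicator fun _ => (1 : ℂ))

/-- The plane wave `ξ ↦ e^{-2πi⟨ξ, x⟩}`, cut off to the ball of radius `R`. -/
def planeWave {d : ℕ} (R : ℝ) (x : E d) : E d → ℂ :=
  (Metric.closedBall (0 : E d) R).indicator
    fun ξ => ((Real.fourierChar (-(inner ℝ ξ x)) : Circle) : ℂ)

theorem memLp_planeWave {d : ℕ} (R : ℝ) (x : E d) (p : ℝ≥0∞) :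
    MemLp (planeWave R x) p volume := by
  have hc : Continuous fun ξ : E d => ((Real.fourierChar (-(inner ℝ ξ x)) : Circle) : ℂ) :=
    continuous_subtype_val.comp (Real.continuous_fourierChar.comp (by fun_prop))
  refine (memLp_indicator_iff_restrict Metric.isClosed_closedBall.measurableSet).2 ?_
  have : IsFiniteMeasure ((volume : Measure (E d)).restrict (Metric.closedBall 0 R)) :=
    ⟨by rw [Measure.restrict_apply_univ]; exact measure_closedBall_lt_top⟩
  exact MemLp.of_bound hc.aestronglyMeasurable 1
    (Eventually.of_forall fun ξ => (Circle.norm_coe _).le)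

theorem planeWave_zero {d : ℕ} (R : ℝ) :
    planeWave R (0 : E d) = (Metric.closedBall (0 : E d) R).indicator fun _ => (1 : ℂ) := by
  simp [planeWave]

theorem continuous_bandKernel (d : ℕ) (R : ℝ) : Continuous (bandKernel d R) := by
  rw [bandKernel, ← planeWave_zero,
    ← Real.Lp.fourierTransformInv_toLp (memLp_planeWave R (0 : E d) 1)]
  exact BoundedContinuousFunction.continuous _

theorem fourierInv_planeWave {d : ℕ} (R : ℝ) (x y : E d) :
    𝓕⁻ (planeWave R x) y = bandKernel d R (y - x) := by
  rw [bandKernel, Real.fourierInv_eq, Real.fourierInv_eq]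
  congr 1
  ext ξ
  by_cases hξ : ξ ∈ Metric.closedBall (0 : E d) R
  · simp only [planeWave, Set.indicator_of_mem hξ, Circle.smul_def, smul_eq_mul, mul_one]
    rw [inner_sub_right, sub_eq_add_neg, AddChar.map_add_eq_mul, Circle.coe_mul]
  · simp only [planeWave, Set.indicator_of_notMem hξ, smul_zero]

/-- Bounded support makes the cut-off function integrable, so the Fourier integral applies; the
inner product conjugates its first argument, which explains the minus sign in `planeWave`. -/
theorem coeFn_fourierInv_ballCutoff {d : ℕ} (R : ℝ) (G : L2 d) :
    ((𝓕⁻ (ballCutoff d R G) : L2 d) : E d → ℂ) =ᵐ[volume]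
      fun x => inner ℂ ((memLp_planeWave R x 2).toLp _) G := by
  have hm : MeasurableSet (Metric.closedBall (0 : E d) R) :=
    Metric.isClosed_closedBall.measurableSet
  have hint : Integrable ((Metric.closedBall (0 : E d) R).indicator G) := by
    rw [integrable_indicator_iff hm]
    have : IsFiniteMeasure ((volume : Measure (E d)).restrict (Metric.closedBall 0 R)) :=
      ⟨by rw [Measure.restrict_apply_univ]; exact measure_closedBall_lt_top⟩
    exact ((Lp.memLp G).restrict _).integrable one_le_two
  filter_upwards [coeFn_fourierInv_toLp ((Lp.memLp G).indicator hm) hint] with x hx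
  refine Eq.trans hx ?_
  rw [Real.fourierInv_eq, L2.inner_def]
  refine integral_congr_ae ?_
  filter_upwards [(memLp_planeWave R x 2).coeFn_toLp] with ξ hξ
  rw [hξ]
  by_cases h : ξ ∈ Metric.closedBall (0 : E d) R
  · simp only [planeWave, Set.indicator_of_mem h, Circle.smul_def, smul_eq_mul,
      RCLike.inner_apply]
    rw [AddChar.map_neg_eq_inv, Circle.coe_inv_eq_conj]
    simp [mul_comm]
  · simp [planeWave, Set.indicator_of_notMem h]

/-! ### Projections and the Hilbert–Schmidt norm of `B_c D_B` -/

theorem inner_ballCutoff {d : ℕ} (r : ℝ) (f g : L2 d) :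
    inner ℂ (ballCutoff d r f) g = inner ℂ f (ballCutoff d r g) := by
  rw [L2.inner_def, L2.inner_def]
  refine integral_congr_ae ?_
  filter_upwards [coeFn_ballCutoff r f, coeFn_ballCutoff r g] with x h1 h2
  rw [h1, h2]
  by_cases h : x ∈ Metric.closedBall (0 : E d) r
  · rw [Set.indicator_of_mem h, Set.indicator_of_mem h]
  · rw [Set.indicator_of_notMem h, Set.indicator_of_notMem h, inner_zero_left, inner_zero_right]

theorem ballCutoff_ballCutoff {d : ℕ} (r : ℝ) (f : L2 d) :
    ballCutoff d r (ballCutoff d r f) = ballCutoff d r f := by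
  apply Lp.ext
  filter_upwards [coeFn_ballCutoff r (ballCutoff d r f), coeFn_ballCutoff r f] with x h1 h2
  rw [h1, h2]
  by_cases h : x ∈ Metric.closedBall (0 : E d) r
  · rw [Set.indicator_of_mem h, h2]
  · rw [Set.indicator_of_notMem h, Set.indicator_of_notMem h]

theorem inner_fourierInv_left {d : ℕ} (f g : L2 d) :
    inner ℂ (𝓕⁻ f : L2 d) g = inner ℂ f (𝓕 g) := by
  rw [← Lp.inner_fourier_eq (𝓕⁻ f) g, FourierTransform.fourier_fourierInv_eq]

theorem inner_fourierInv_right {d : ℕ} (f g : L2 d) :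
    inner ℂ g (𝓕⁻ f : L2 d) = inner ℂ (𝓕 g) f := by
  rw [← inner_conj_symm, inner_fourierInv_left, inner_conj_symm]

theorem inner_bandLimit {d : ℕ} (c : ℝ) (f g : L2 d) :
    inner ℂ (bandLimit d c f) g = inner ℂ f (bandLimit d c g) := by
  rw [bandLimit_apply, bandLimit_apply, inner_fourierInv_left, inner_fourierInv_right,
    inner_ballCutoff]

theorem bandLimit_bandLimit {d : ℕ} (c : ℝ) (f : L2 d) :
    bandLimit d c (bandLimit d c f) = bandLimit d c f := by
  simp only [bandLimit_apply, FourierTransform.fourier_fourierInv_eq, ballCutoff_ballCutoff]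

/-- The operator `B_c D_B`. -/
def bandTime (d : ℕ) (c : ℝ) : L2 d →L[ℂ] L2 d := bandLimit d c ∘L ballCutoff d 1

/-- The representing vector of point evaluation at `x` composed with `B_c D_B`. -/
def reproducing {d : ℕ} (c : ℝ) (x : E d) : L2 d :=
  ballCutoff d 1 (𝓕⁻ ((memLp_planeWave ((2 * Real.pi)⁻¹ * c) x 2).toLp _))

theorem coeFn_bandTime {d : ℕ} (c : ℝ) (f : L2 d) :
    bandTime d c f =ᵐ[volume] fun x => inner ℂ (reproducing c x) f := by
  have h : bandTime d c f
      = 𝓕⁻ (ballCutoff d ((2 * Real.pi)⁻¹ * c) (𝓕 (ballCutoff d 1 f))) :=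
    bandLimit_apply d c _
  rw [h]
  filter_upwards [coeFn_fourierInv_ballCutoff ((2 * Real.pi)⁻¹ * c)
    (𝓕 (ballCutoff d 1 f))] with x hx
  rw [hx, reproducing, inner_ballCutoff, inner_fourierInv_left]

theorem enorm_sq_eq_lintegral {d : ℕ} (f : L2 d) : ‖f‖ₑ ^ 2 = ∫⁻ x, ‖f x‖ₑ ^ 2 := by
  rw [Lp.enorm_def, eLpNorm_eq_lintegral_rpow_enorm_toReal two_ne_zero ENNReal.ofNat_ne_top]
  simp only [ENNReal.toReal_ofNat, one_div, ENNReal.rpow_ofNat]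
  rw [← ENNReal.rpow_natCast, ← ENNReal.rpow_mul]
  norm_num

theorem enorm_ballCutoff_sq {d : ℕ} (r : ℝ) (f : L2 d) :
    ‖ballCutoff d r f‖ₑ ^ 2 = ∫⁻ x in Metric.closedBall (0 : E d) r, ‖f x‖ₑ ^ 2 := by
  rw [enorm_sq_eq_lintegral, ← lintegral_indicator Metric.isClosed_closedBall.measurableSet]
  refine lintegral_congr_ae ?_
  filter_upwards [coeFn_ballCutoff r f] with x hx
  rw [hx]
  by_cases h : x ∈ Metric.closedBall (0 : E d) r
  · rw [Set.indicator_of_mem h, Set.indicator_of_mem h]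
  · rw [Set.indicator_of_notMem h, Set.indicator_of_notMem h]
    simp

theorem enorm_reproducing_sq {d : ℕ} (c : ℝ) (x : E d) :
    ‖reproducing c x‖ₑ ^ 2 = ∫⁻ y in Metric.closedBall (0 : E d) 1,
      ‖bandKernel d ((2 * Real.pi)⁻¹ * c) (y - x)‖ₑ ^ 2 := by
  rw [reproducing, enorm_ballCutoff_sq]
  refine lintegral_congr_ae (ae_restrict_of_ae ?_)
  filter_upwards [coeFn_fourierInv_toLp (memLp_planeWave ((2 * Real.pi)⁻¹ * c) x 2)
    (memLp_one_iff_integrable.1 (memLp_planeWave ((2 * Real.pi)⁻¹ * c) x 1))] with y hy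
  rw [hy, fourierInv_planeWave]

theorem lintegral_bandKernel {d : ℕ} (R : ℝ) :
    ∫⁻ z, ‖bandKernel d R z‖ₑ ^ 2 = volume (Metric.closedBall (0 : E d) R) := by
  have h1 := coeFn_fourierInv_toLp (memLp_planeWave R (0 : E d) 2)
    (memLp_one_iff_integrable.1 (memLp_planeWave R (0 : E d) 1))
  have h2 : ∫⁻ z, ‖bandKernel d R z‖ₑ ^ 2
      = ‖(𝓕⁻ ((memLp_planeWave R (0 : E d) 2).toLp _) : L2 d)‖ₑ ^ 2 := by
    rw [enorm_sq_eq_lintegral]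
    refine lintegral_congr_ae ?_
    filter_upwards [h1] with z hz
    rw [hz, fourierInv_planeWave, sub_zero]
  have h3 : ‖(𝓕⁻ ((memLp_planeWave R (0 : E d) 2).toLp _) : L2 d)‖ₑ
      = ‖(memLp_planeWave R (0 : E d) 2).toLp _‖ₑ :=
    (Lp.fourierTransformₗᵢ (E d) ℂ).symm.enorm_map _
  rw [h2, h3, enorm_sq_eq_lintegral, ← setLIntegral_one,
    ← lintegral_indicator Metric.isClosed_closedBall.measurableSet]
  refine lintegral_congr_ae ?_
  filter_upwards [(memLp_planeWave R (0 : E d) 2).coeFn_toLp] with z hz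
  rw [hz, planeWave_zero]
  by_cases h : z ∈ Metric.closedBall (0 : E d) R
  · rw [Set.indicator_of_mem h, Set.indicator_of_mem h]
    simp
  · rw [Set.indicator_of_notMem h, Set.indicator_of_notMem h]
    simp

/-- Orthonormal vectors lie at distance `√2`, so balls of radius `1/2` about them are disjoint.
Countability is needed to exchange sum and integral. -/
theorem countable_of_orthonormal {H ι : Type*} [NormedAddCommGroup H] [InnerProductSpace ℂ H]
    [SecondCountableTopology H] {v : ι → H} (hv : Orthonormal ℂ v) : Countable ι := by
  have hd : Pairwise (Function.onFun Disjoint fun i => Metric.ball (v i) (1 / 2)) := by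
    intro i j hij
    refine Metric.ball_disjoint_ball ?_
    have h : ‖v i - v j‖ ^ 2 = 2 := by
      rw [@norm_sub_sq ℂ, hv.1 i, hv.1 j, hv.2 hij]
      norm_num
    rw [dist_eq_norm]
    nlinarith [norm_nonneg (v i - v j)]
  have h := Set.PairwiseDisjoint.countable_of_isOpen (s := fun i => Metric.ball (v i) (1 / 2))
    (a := Set.univ) (fun i _ j _ hij => hd hij) (fun i _ => Metric.isOpen_ball)
    (fun i _ => ⟨v i, Metric.mem_ball_self (by norm_num)⟩)
  exact Set.countable_univ_iff.1 h

theorem tsum_enorm_inner_sq {H ι : Type*} [NormedAddCommGroup H] [InnerProductSpace ℂ H]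
    (b : HilbertBasis ι ℂ H) (x : H) : ∑' i, ‖inner ℂ x (b i)‖ₑ ^ 2 = ‖x‖ₑ ^ 2 := by
  have h := (b.hasSum_inner_mul_inner x x)
  have h2 : HasSum (fun i => ‖inner ℂ x (b i)‖ ^ 2) (‖x‖ ^ 2) := by
    have h3 := Complex.hasSum_re h
    convert h3 using 1
    · ext i
      rw [← inner_conj_symm (b i) x, Complex.mul_conj, Complex.normSq_eq_norm_sq,
        Complex.ofReal_re]
    · rw [inner_self_eq_norm_sq_to_K]
      norm_cast
  have h4 := ENNReal.ofReal_tsum_of_nonneg (fun i => by positivity) h2.summable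
  rw [h2.tsum_eq] at h4
  rw [← ofReal_norm, ← ENNReal.ofReal_pow (norm_nonneg _), h4]
  refine tsum_congr fun i => ?_
  rw [← ofReal_norm, ← ENNReal.ofReal_pow (norm_nonneg _)]

/-- Parseval, applied at each point `x` to the representing vector. `S = univ` yields the trace of
`Q_c`, and `S = Bᶜ` the leakage. -/
theorem tsum_lintegral_bandTime {d : ℕ} {ι : Type*} (b : HilbertBasis ι ℂ (L2 d)) (c : ℝ)
    (S : Set (E d)) :
    ∑' i, ∫⁻ x in S, ‖bandTime d c (b i) x‖ₑ ^ 2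
      = ∫⁻ x in S, ∫⁻ y in Metric.closedBall (0 : E d) 1,
          ‖bandKernel d ((2 * Real.pi)⁻¹ * c) (y - x)‖ₑ ^ 2 := by
  have : Fact ((2 : ℝ≥0∞) ≠ ∞) := ⟨ENNReal.ofNat_ne_top⟩
  have : Countable ι := countable_of_orthonormal b.orthonormal
  rw [← lintegral_tsum fun i =>
    ((Lp.aestronglyMeasurable (bandTime d c (b i))).enorm.pow_const 2).restrict]
  refine lintegral_congr_ae (ae_restrict_of_ae ?_)
  filter_upwards [ae_all_iff.2 fun i => coeFn_bandTime c (b i)] with x hx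
  simp_rw [hx]
  rw [tsum_enorm_inner_sq, enorm_reproducing_sq]

/-! ### The leakage is `o(R^d)` -/

/-- The Hilbert–Schmidt norm of `(1 - D_B) B_c D_B`, squared. -/
def leakage (d : ℕ) (R : ℝ) : ℝ≥0∞ :=
  ∫⁻ x in (Metric.closedBall (0 : E d) 1)ᶜ, ∫⁻ y in Metric.closedBall (0 : E d) 1,
    ‖bandKernel d R (y - x)‖ₑ ^ 2

theorem lintegral_closedBall_bandKernel {d : ℕ} (R : ℝ) :
    ∫⁻ x : E d, ∫⁻ y in Metric.closedBall (0 : E d) 1, ‖bandKernel d R (y - x)‖ₑ ^ 2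
      = volume (Metric.closedBall (0 : E d) 1) * volume (Metric.closedBall (0 : E d) R) := by
  have hm : Measurable fun p : E d × E d => ‖bandKernel d R (p.2 - p.1)‖ₑ ^ 2 :=
    ((continuous_bandKernel d R).comp (by fun_prop)).measurable.enorm.pow_const 2
  rw [lintegral_lintegral_swap hm.aemeasurable]
  have h : ∀ y : E d, ∫⁻ x : E d, ‖bandKernel d R (y - x)‖ₑ ^ 2
      = volume (Metric.closedBall (0 : E d) R) := fun y => by
    rw [lintegral_sub_left_eq_self (fun z => ‖bandKernel d R z‖ₑ ^ 2) y, lintegral_bandKernel]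
  simp_rw [h]
  rw [lintegral_const, Measure.restrict_apply_univ, mul_comm]

theorem enorm_bandKernel_eq {d : ℕ} {R : ℝ} (hR : 0 < R) (z : E d) :
    ‖bandKernel d R z‖ₑ = ENNReal.ofReal (R ^ d) * ‖bandKernel d 1 (R • z)‖ₑ := by
  have h : bandKernel d 1 (R • z) = ((R ^ d)⁻¹ : ℝ) • bandKernel d R z := by
    rw [bandKernel, bandKernel, Real.fourierInv_eq, Real.fourierInv_eq]
    have h1 := Measure.integral_comp_smul (volume : Measure (E d))
      (fun v => Real.fourierChar (inner ℝ v z) •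
        (Metric.closedBall (0 : E d) R).indicator (fun _ => (1 : ℂ)) v) R
    rw [finrank_euclideanSpace_fin, abs_of_pos (by positivity)] at h1
    rw [← h1]
    congr 1
    ext v
    rw [real_inner_smul_left, real_inner_smul_right]
    congr 1
    by_cases hv : v ∈ Metric.closedBall (0 : E d) 1
    · rw [Set.indicator_of_mem hv, Set.indicator_of_mem]
      rw [mem_closedBall_zero_iff] at hv ⊢
      rw [norm_smul, Real.norm_eq_abs, abs_of_pos hR]
      nlinarith
    · rw [Set.indicator_of_notMem hv, Set.indicator_of_notMem]
      rw [mem_closedBall_zero_iff] at hv ⊢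
      rw [norm_smul, Real.norm_eq_abs, abs_of_pos hR]
      intro h
      exact hv (by nlinarith)
  rw [h, enorm_smul, Real.enorm_eq_ofReal (by positivity), ← mul_assoc,
    ← ENNReal.ofReal_mul (by positivity), mul_inv_cancel₀ (by positivity)]
  simp

/-- Substitute `z = y - x`, then `w = R z`. The squared kernel contributes `R^(2d)` and the Jacobian
`R^(-d)`. -/
theorem leakage_eq {d : ℕ} {R : ℝ} (hR : 0 < R) :
    leakage d R = ENNReal.ofReal (R ^ d) * ∫⁻ w : E d, ‖bandKernel d 1 w‖ₑ ^ 2 *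
      volume {y | y ∈ Metric.closedBall (0 : E d) 1 ∧
        y - R⁻¹ • w ∉ Metric.closedBall (0 : E d) 1} := by
  set B := Metric.closedBall (0 : E d) 1 with hB
  have hBm : MeasurableSet B := Metric.isClosed_closedBall.measurableSet
  have hk : Measurable fun z : E d => ‖bandKernel d R z‖ₑ ^ 2 :=
    (continuous_bandKernel d R).measurable.enorm.pow_const 2
  have hm : Measurable fun p : E d × E d => ‖bandKernel d R (p.2 - p.1)‖ₑ ^ 2 :=
    hk.comp (measurable_snd.sub measurable_fst)
  have hset : ∀ z : E d, MeasurableSet {y | y ∈ B ∧ y - z ∉ B} := fun z =>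
    hBm.inter ((measurable_id.sub_const z) hBm.compl)
  have h1 : leakage d R = ∫⁻ z : E d, ‖bandKernel d R z‖ₑ ^ 2 * volume {y | y ∈ B ∧ y - z ∉ B} := by
    rw [leakage, ← hB, lintegral_lintegral_swap hm.aemeasurable]
    have h2 : ∀ y : E d, ∫⁻ x in Bᶜ, ‖bandKernel d R (y - x)‖ₑ ^ 2
        = ∫⁻ z : E d, ‖bandKernel d R z‖ₑ ^ 2 * Bᶜ.indicator 1 (y - z) := fun y => by
      rw [← lintegral_indicator hBm.compl,
        ← lintegral_sub_left_eq_self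
          (fun z => ‖bandKernel d R z‖ₑ ^ 2 * Bᶜ.indicator 1 (y - z)) y]
      refine lintegral_congr fun x => ?_
      rw [sub_sub_cancel]
      by_cases hx : x ∈ Bᶜ
      · rw [Set.indicator_of_mem hx, Set.indicator_of_mem hx, Pi.one_apply, mul_one]
      · rw [Set.indicator_of_notMem hx, Set.indicator_of_notMem hx, mul_zero]
    simp_rw [h2]
    have hm2 : Measurable fun p : E d × E d =>
        ‖bandKernel d R p.2‖ₑ ^ 2 * Bᶜ.indicator (1 : E d → ℝ≥0∞) (p.1 - p.2) :=
      (hk.comp measurable_snd).mul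
        ((measurable_one.indicator hBm.compl).comp (measurable_fst.sub measurable_snd))
    rw [lintegral_lintegral_swap hm2.aemeasurable]
    refine lintegral_congr fun z => ?_
    rw [lintegral_const_mul' _ _ (by finiteness), ← lintegral_indicator hBm,
      ← lintegral_indicator_one (hset z)]
    congr 1
    refine lintegral_congr fun y => ?_
    by_cases hy : y ∈ B
    · rw [Set.indicator_of_mem hy]
      by_cases hz : y - z ∈ Bᶜ
      · rw [Set.indicator_of_mem hz,
          Set.indicator_of_mem (show y ∈ {y | y ∈ B ∧ y - z ∉ B} from ⟨hy, hz⟩)]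
        rfl
      · rw [Set.indicator_of_notMem hz, Set.indicator_of_notMem (fun h => hz h.2)]
    · rw [Set.indicator_of_notMem hy, Set.indicator_of_notMem (fun h => hy h.1)]
  have hRd : (0 : ℝ) < R ^ d := by positivity
  have hscale : ∀ F : E d → ℝ≥0∞, ∫⁻ z, F (R • z) = ENNReal.ofReal ((R ^ d)⁻¹) * ∫⁻ w, F w := by
    intro F
    have := (Homeomorph.smulOfNeZero R hR.ne' : E d ≃ₜ E d).measurableEmbedding.lintegral_map
      (μ := volume) F
    simp only [Homeomorph.smulOfNeZero_apply] at this
    rw [← this, Measure.map_addHaar_smul volume hR.ne',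
      lintegral_smul_measure, finrank_euclideanSpace_fin, abs_of_pos (by positivity), smul_eq_mul]
  have h3 : leakage d R = ENNReal.ofReal (R ^ d) ^ 2 * ∫⁻ z : E d,
      ‖bandKernel d 1 (R • z)‖ₑ ^ 2 * volume {y | y ∈ B ∧ y - R⁻¹ • (R • z) ∉ B} := by
    rw [h1, ← lintegral_const_mul' _ _ (by finiteness)]
    refine lintegral_congr fun z => ?_
    rw [enorm_bandKernel_eq hR, mul_pow, mul_assoc, inv_smul_smul₀ hR.ne']
  rw [h3, hscale fun w => ‖bandKernel d 1 w‖ₑ ^ 2 * volume {y | y ∈ B ∧ y - R⁻¹ • w ∉ B},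
    ← mul_assoc, sq, mul_assoc (ENNReal.ofReal _), ← ENNReal.ofReal_mul hRd.le,
    mul_inv_cancel₀ hRd.ne', ENNReal.ofReal_one, mul_one]

/-- An interior point of the ball remains in it under small translations, and the sphere is a null
set. -/
theorem tendsto_volume_sub_notMem {d : ℕ} :
    Tendsto (fun z : E d => volume {y | y ∈ Metric.closedBall (0 : E d) 1 ∧
      y - z ∉ Metric.closedBall (0 : E d) 1}) (nhds 0) (nhds 0) := by
  set B := Metric.closedBall (0 : E d) 1 with hB
  have hBm : MeasurableSet B := Metric.isClosed_closedBall.measurableSet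
  have hset : ∀ z : E d, MeasurableSet {y | y ∈ B ∧ y - z ∉ B} := fun z =>
    hBm.inter ((measurable_id.sub_const z) hBm.compl)
  have hB1 : volume B ≠ ∞ := measure_closedBall_lt_top.ne
  have h := tendsto_lintegral_filter_of_dominated_convergence (μ := (volume : Measure (E d)))
    (l := nhds (0 : E d)) (F := fun z => {y | y ∈ B ∧ y - z ∉ B}.indicator 1) (f := fun _ => 0)
    (B.indicator 1) (Eventually.of_forall fun z => measurable_one.indicator (hset z))
    (Eventually.of_forall fun z => Eventually.of_forall fun y =>
      Set.indicator_le_indicator_of_subset (fun _ h => h.1) (fun _ => zero_le) y)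
    (by rwa [lintegral_indicator_one hBm])
    (by
      have hs : ∀ᵐ y : E d, y ∉ Metric.sphere (0 : E d) 1 := by
        exact measure_eq_zero_iff_ae_notMem.1
          (Measure.addHaar_sphere_of_ne_zero volume 0 one_ne_zero)
      filter_upwards [hs] with y hy
      refine tendsto_nhds_of_eventually_eq ?_
      by_cases hyB : y ∈ B
      · have hlt : ‖y‖ < 1 := by
          rw [mem_closedBall_zero_iff] at hyB
          rw [mem_sphere_zero_iff_norm] at hy
          exact lt_of_le_of_ne hyB hy
        have hc : Tendsto (fun z : E d => ‖y - z‖) (nhds 0) (nhds ‖y‖) := by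
          have : Continuous fun z : E d => ‖y - z‖ := by fun_prop
          simpa using this.tendsto 0
        filter_upwards [hc.eventually_lt_const hlt] with z hz
        exact Set.indicator_of_notMem (fun h => h.2 (mem_closedBall_zero_iff.2 hz.le)) _
      · exact Eventually.of_forall fun z => Set.indicator_of_notMem (fun h => hyB h.1) _)
  simp only [lintegral_zero] at h
  refine h.congr fun z => lintegral_indicator_one (hset z)

/-- Dominated convergence with majorant `|K_1|² |B|`, integrable by Plancherel. -/
theorem tendsto_leakage_div {d : ℕ} :
    Tendsto (fun R : ℝ => leakage d R / ENNReal.ofReal (R ^ d)) atTop (nhds 0) := by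
  set B := Metric.closedBall (0 : E d) 1 with hB
  have hBm : MeasurableSet B := Metric.isClosed_closedBall.measurableSet
  have hB1 : volume B ≠ ∞ := measure_closedBall_lt_top.ne
  have hk : Measurable fun z : E d => ‖bandKernel d 1 z‖ₑ ^ 2 :=
    (continuous_bandKernel d 1).measurable.enorm.pow_const 2
  have hmeas : Measurable fun z : E d => volume {y | y ∈ B ∧ y - z ∉ B} := by
    have : MeasurableSet {p : E d × E d | p.2 ∈ B ∧ p.2 - p.1 ∉ B} :=
      (measurable_snd hBm).inter ((measurable_snd.sub measurable_fst) hBm.compl)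
    exact measurable_measure_prodMk_left this
  have h := tendsto_lintegral_filter_of_dominated_convergence (μ := (volume : Measure (E d)))
    (l := (atTop : Filter ℝ)) (F := fun R w => ‖bandKernel d 1 w‖ₑ ^ 2 *
      volume {y | y ∈ B ∧ y - R⁻¹ • w ∉ B}) (f := fun _ => 0)
    (fun w => ‖bandKernel d 1 w‖ₑ ^ 2 * volume B)
    (Eventually.of_forall fun R => hk.mul (hmeas.comp (measurable_id.const_smul R⁻¹)))
    (Eventually.of_forall fun R => Eventually.of_forall fun w => by
      gcongr
      exact fun _ h => h.1)
    (by
      rw [lintegral_mul_const' _ _ hB1, lintegral_bandKernel]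
      exact ENNReal.mul_ne_top hB1 hB1)
    (Eventually.of_forall fun w => by
      have h1 : Tendsto (fun R : ℝ => R⁻¹ • w) atTop (nhds 0) := by
        simpa using (tendsto_inv_atTop_zero (𝕜 := ℝ)).smul_const w
      have h2 := ENNReal.Tendsto.const_mul (a := ‖bandKernel d 1 w‖ₑ ^ 2)
        (tendsto_volume_sub_notMem.comp h1) (Or.inr (by finiteness))
      rwa [mul_zero] at h2)
  simp only [lintegral_zero] at h
  refine h.congr' ?_
  filter_upwards [eventually_gt_atTop 0] with R hR
  rw [leakage_eq hR, mul_comm (ENNReal.ofReal _), ENNReal.mul_div_cancel_right]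
  · simpa using pow_pos hR d
  · finiteness

/-! ### Hilbert–Schmidt operators and eigenbases -/

/-- A bounded operator with finite Hilbert–Schmidt norm is compact. -/
theorem isCompactOperator_of_summable {H ι : Type*} [NormedAddCommGroup H]
    [InnerProductSpace ℂ H] [CompleteSpace H] (b : HilbertBasis ι ℂ H) (A : H →L[ℂ] H)
    (hA : Summable fun i => ‖A (b i)‖ ^ 2) : IsCompactOperator A := by
  -- `F s` is `A` composed with the projection onto the span of the `b i`, `i ∈ s`: a finite-rank
  -- approximation.
  let F : Finset ι → H →L[ℂ] H := fun s =>
    ∑ i ∈ s, (innerSL ℂ (b i)).smulRight (A (b i))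
  have hF : ∀ s x, F s x = ∑ i ∈ s, (inner ℂ (b i) x : ℂ) • A (b i) := fun s x => by
    simp [F]
  have hfin : ∀ s, IsCompactOperator (F s) := by
    intro s
    refine Submodule.sum_mem (compactOperator (RingHom.id ℂ) H H) (f := fun i =>
      (innerSL ℂ (b i)).smulRight (A (b i))) fun i _ => ?_
    have h : IsCompactOperator (innerSL ℂ (b i)) :=
      isCompactOperator_of_locallyCompactSpace_dom _
    exact (h.clm_comp (ContinuousLinearMap.toSpanSingleton ℂ (A (b i))) :)
  refine isCompactOperator_of_tendsto (l := atTop) (F := F) ?_ (Eventually.of_forall hfin)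
  have hsum : ∀ x, HasSum (fun i => (inner ℂ (b i) x : ℂ) • A (b i)) (A x) := fun x => by
    have h := (b.hasSum_repr x).mapL A
    simpa [HilbertBasis.repr_apply_apply] using h
  -- Cauchy–Schwarz and Bessel bound the operator norm of the error by a tail of the convergent
  -- series.
  have hbound : ∀ s x, ‖F s x - A x‖ ≤
      Real.sqrt (∑' i : {i // i ∉ s}, ‖A (b i)‖ ^ 2) * ‖x‖ := by
    intro s x
    have h1 : HasSum (fun i : {i // i ∉ s} => (inner ℂ (b i) x : ℂ) • A (b i)) (A x - F s x) := by
      rw [hF]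
      have := (s.hasSum_compl_iff (f := fun i => (inner ℂ (b i) x : ℂ) • A (b i))
        (a := A x - ∑ i ∈ s, (inner ℂ (b i) x : ℂ) • A (b i))).2
        (by simpa using hsum x)
      exact this
    rw [norm_sub_rev]
    have hs2 : Summable fun i : {i // i ∉ s} => ‖A (b i)‖ ^ 2 := hA.subtype _
    have hx2 : HasSum (fun i => ‖inner ℂ (b i) x‖ ^ 2) (‖x‖ ^ 2) := by
      have h3 := Complex.hasSum_re (b.hasSum_inner_mul_inner x x)
      convert h3 using 1
      · ext i
        rw [← inner_conj_symm x (b i), mul_comm, Complex.mul_conj, Complex.normSq_eq_norm_sq,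
          Complex.ofReal_re]
      · rw [inner_self_eq_norm_sq_to_K]
        norm_cast
    refine le_of_tendsto h1.norm (Eventually.of_forall fun t => ?_)
    calc ‖∑ i ∈ t, (inner ℂ (b i) x : ℂ) • A (b i)‖
        ≤ ∑ i ∈ t, ‖A (b i)‖ * ‖inner ℂ (b (i : ι)) x‖ :=
          (norm_sum_le _ _).trans (Finset.sum_le_sum fun i _ => by rw [norm_smul, mul_comm])
      _ ≤ Real.sqrt (∑ i ∈ t, ‖A (b i)‖ ^ 2) * Real.sqrt (∑ i ∈ t, ‖inner ℂ (b (i : ι)) x‖ ^ 2) :=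
          Real.sum_mul_le_sqrt_mul_sqrt _ _ _
      _ ≤ Real.sqrt (∑' i : {i // i ∉ s}, ‖A (b i)‖ ^ 2) * ‖x‖ := by
          gcongr
          · exact hs2.sum_le_tsum t fun i _ => by positivity
          · rw [Real.sqrt_le_left (norm_nonneg _), ← hx2.tsum_eq]
            exact ((hx2.summable.subtype _).sum_le_tsum t fun i _ => sq_nonneg _).trans
              (hx2.summable.tsum_subtype_le (fun i => ‖inner ℂ (b i) x‖ ^ 2) {i | i ∉ s}
                fun i => by positivity)
  rw [tendsto_iff_norm_sub_tendsto_zero]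
  have hlim := (tendsto_tsum_compl_atTop_zero fun i => ‖A (b i)‖ ^ 2).sqrt
  rw [Real.sqrt_zero] at hlim
  exact squeeze_zero (fun _ => norm_nonneg _)
    (fun s => ContinuousLinearMap.opNorm_le_bound _ (Real.sqrt_nonneg _) (hbound s)) hlim

/-- A compact symmetric operator has a Hilbert basis of eigenvectors, obtained by joining Hilbert
bases of its eigenspaces. -/
theorem exists_hilbertBasis_eigenspace {H : Type*} [NormedAddCommGroup H]
    [InnerProductSpace ℂ H] [CompleteSpace H] (T : H →L[ℂ] H) (hT : IsCompactOperator T)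
    (hs : (T : H →ₗ[ℂ] H).IsSymmetric) :
    ∃ (w : ∀ μ : ℂ, Set (Module.End.eigenspace (T : H →ₗ[ℂ] H) μ))
      (_ : ∀ μ, HilbertBasis (w μ) ℂ (Module.End.eigenspace (T : H →ₗ[ℂ] H) μ))
      (b : HilbertBasis (Σ μ, w μ) ℂ H), ∀ i, T (b i) = i.1 • b i := by
  have hcl : ∀ μ, IsClosed (Module.End.eigenspace (T : H →ₗ[ℂ] H) μ : Set H) := fun μ => by
    have : (Module.End.eigenspace (T : H →ₗ[ℂ] H) μ : Set H) = {x | T x = μ • x} := by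
      ext x
      exact Module.End.mem_eigenspace_iff
    rw [this]
    exact isClosed_eq T.continuous (continuous_const_smul μ)
  have : ∀ μ, CompleteSpace (Module.End.eigenspace (T : H →ₗ[ℂ] H) μ) := fun μ =>
    (hcl μ).completeSpace_coe
  choose w b hb using fun μ => exists_hilbertBasis ℂ (Module.End.eigenspace (T : H →ₗ[ℂ] H) μ)
  have hon : Orthonormal ℂ fun a : Σ μ, w μ =>
      ((b a.1 a.2 : Module.End.eigenspace (T : H →ₗ[ℂ] H) a.1) : H) :=
    hs.orthogonalFamily_eigenspaces.orthonormal_sigma_orthonormal fun μ => (b μ).orthonormal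
  -- A vector orthogonal to all basis vectors is orthogonal to every eigenspace, by expanding there;
  -- the spectral theorem then forces it to vanish.
  have hbot : (Submodule.span ℂ (Set.range fun a : Σ μ, w μ =>
      ((b a.1 a.2 : Module.End.eigenspace (T : H →ₗ[ℂ] H) a.1) : H)))ᗮ = ⊥ := by
    rw [eq_bot_iff, ← ContinuousLinearMap.orthogonalComplement_iSup_eigenspaces_eq_bot hT hs,
      ← Submodule.iInf_orthogonal]
    refine fun v hv => Submodule.mem_iInf _ |>.2 fun μ => ?_
    rw [Submodule.mem_orthogonal']
    intro x hx
    have h1 := ((b μ).hasSum_repr ⟨x, hx⟩).mapL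
      (innerSL ℂ v ∘L (Module.End.eigenspace (T : H →ₗ[ℂ] H) μ).subtypeL)
    have h0 : ∀ i, (innerSL ℂ v ∘L (Module.End.eigenspace (T : H →ₗ[ℂ] H) μ).subtypeL)
        ((b μ).repr ⟨x, hx⟩ i • b μ i) = 0 := fun i => by
      have := (Submodule.mem_orthogonal' _ v).1 hv _ (Submodule.subset_span ⟨⟨μ, i⟩, rfl⟩)
      simp [this]
    simp_rw [h0] at h1
    exact h1.unique hasSum_zero
  refine ⟨w, b, HilbertBasis.mkOfOrthogonalEqBot hon hbot, fun i => ?_⟩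
  rw [HilbertBasis.coe_mkOfOrthogonalEqBot]
  exact Module.End.mem_eigenspace_iff.1 (b i.1 i.2).2

theorem rank_eq_mk_of_hilbertBasis {V : Type*} [NormedAddCommGroup V] [InnerProductSpace ℂ V]
    [FiniteDimensional ℂ V] {w : Set V} (b : HilbertBasis w ℂ V) :
    Module.rank ℂ V = Cardinal.mk w := by
  have hf : Finite w := b.orthonormal.linearIndependent.finite
  have := Fintype.ofFinite w
  rw [← b.toOrthonormalBasis.toBasis.mk_eq_rank'']

/-! ### Spectrum of `Q_c` and the eigenvalue count -/

theorem Q_apply (d : ℕ) (c : ℝ) (f : L2 d) : Q d c f = ballCutoff d 1 (bandTime d c f) := rfl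

/-- This is `Q_c = T* T` with `T = B_c D_B`, from `B_c² = B_c = B_c*`. -/
theorem inner_Q {d : ℕ} (c : ℝ) (f g : L2 d) :
    inner ℂ f (Q d c g) = inner ℂ (bandTime d c f) (bandTime d c g) := by
  rw [Q_apply, ← inner_ballCutoff]
  change inner ℂ _ (bandLimit d c (ballCutoff d 1 g))
    = inner ℂ (bandLimit d c (ballCutoff d 1 f)) (bandLimit d c (ballCutoff d 1 g))
  rw [inner_bandLimit c (ballCutoff d 1 f), bandLimit_bandLimit]

theorem isSymmetric_Q (d : ℕ) (c : ℝ) : (Q d c : L2 d →ₗ[ℂ] L2 d).IsSymmetric := fun f g => by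
  change inner ℂ (Q d c f) g = inner ℂ f (Q d c g)
  rw [inner_Q, ← inner_conj_symm, inner_Q, inner_conj_symm]

theorem ofReal_norm_sq {H : Type*} [SeminormedAddCommGroup H] (x : H) :
    ENNReal.ofReal (‖x‖ ^ 2) = ‖x‖ₑ ^ 2 := by
  rw [ENNReal.ofReal_pow (norm_nonneg _), ofReal_norm]

theorem tsum_enorm_bandTime_sq {d : ℕ} {ι : Type*} (b : HilbertBasis ι ℂ (L2 d)) (c : ℝ) :
    ∑' i, ‖bandTime d c (b i)‖ₑ ^ 2 = volume (Metric.closedBall (0 : E d) 1) *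
      volume (Metric.closedBall (0 : E d) ((2 * Real.pi)⁻¹ * c)) := by
  have h := tsum_lintegral_bandTime b c Set.univ
  simp only [Measure.restrict_univ] at h
  rw [lintegral_closedBall_bandKernel] at h
  simpa only [enorm_sq_eq_lintegral] using h

theorem isCompactOperator_Q (d : ℕ) (c : ℝ) : IsCompactOperator (Q d c) := by
  obtain ⟨w, b, -⟩ := exists_hilbertBasis ℂ (L2 d)
  have hfin : ∑' i, ENNReal.ofReal (‖bandTime d c (b i)‖ ^ 2) ≠ ∞ := by
    simp_rw [ofReal_norm_sq]
    rw [tsum_enorm_bandTime_sq]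
    exact ENNReal.mul_ne_top measure_closedBall_lt_top.ne measure_closedBall_lt_top.ne
  have hs : Summable fun i => ‖bandTime d c (b i)‖ ^ 2 := by
    refine (ENNReal.summable_toReal hfin).congr fun i => ?_
    rw [ENNReal.toReal_ofReal (by positivity)]
  exact (isCompactOperator_of_summable b (bandTime d c) hs).clm_comp (ballCutoff d 1)

/-- Counting numbers `λ i ∈ [0, 1]` above a level `δ` by their sum. -/
theorem abs_ncard_sub_tsum_le {ι : Type*} {l : ι → ℝ} (h0 : ∀ i, 0 ≤ l i) (h1 : ∀ i, l i ≤ 1)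
    (hs : Summable l) {δ : ℝ} (hδ₀ : 0 < δ) (hδ₁ : δ < 1) :
    {i | δ ≤ l i}.Finite ∧ |({i | δ ≤ l i}.ncard : ℝ) - ∑' i, l i| ≤
      (δ⁻¹ + (1 - δ)⁻¹) * ∑' i, l i * (1 - l i) := by
  have hfin : {i | δ ≤ l i}.Finite := by
    have := hs.tendsto_cofinite_zero.eventually_lt_const hδ₀
    simpa [Filter.Eventually, Filter.mem_cofinite, Set.compl_def] using this
  refine ⟨hfin, ?_⟩
  have hδ' : 0 < 1 - δ := by linarith
  have hsum2 : Summable fun i => l i * (1 - l i) :=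
    Summable.of_nonneg_of_le (fun i => mul_nonneg (h0 i) (by linarith [h1 i]))
      (fun i => by nlinarith [h0 i, h1 i]) hs
  have hind : HasSum ({i | δ ≤ l i}.indicator fun _ => (1 : ℝ)) ({i | δ ≤ l i}.ncard : ℝ) := by
    have h := hasSum_sum_of_ne_finset_zero (L := SummationFilter.unconditional ι)
      (f := {i | δ ≤ l i}.indicator fun _ => (1 : ℝ))
      (s := hfin.toFinset) (fun i hi => Set.indicator_of_notMem (by simpa using hi) _)
    rw [Finset.sum_congr rfl fun i hi =>
      Set.indicator_of_mem (hfin.mem_toFinset.1 hi) _] at h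
    rw [Set.ncard_eq_toFinset_card _ hfin]
    simpa using h
  have hdiff := hind.sub hs.hasSum
  -- If `λ ≥ δ` the difference is `1 - λ ≤ δ⁻¹ λ (1 - λ)`; otherwise it is `λ ≤ (1 - δ)⁻¹ λ (1 -
  -- λ)`.
  have hbd : ∀ i, ‖{i | δ ≤ l i}.indicator (fun _ => (1 : ℝ)) i - l i‖ ≤
      (δ⁻¹ + (1 - δ)⁻¹) * (l i * (1 - l i)) := by
    intro i
    have hi := h0 i
    have hi1 := h1 i
    have hnn : 0 ≤ l i * (1 - l i) := mul_nonneg hi (by linarith)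
    rw [Real.norm_eq_abs, add_mul]
    by_cases h : δ ≤ l i
    · rw [Set.indicator_of_mem (show i ∈ {i | δ ≤ l i} from h), abs_of_nonneg (by linarith)]
      have h2 : 1 - l i ≤ δ⁻¹ * (l i * (1 - l i)) := by
        rw [inv_mul_eq_div, le_div_iff₀ hδ₀]
        nlinarith
      have h3 : 0 ≤ (1 - δ)⁻¹ * (l i * (1 - l i)) := by positivity
      linarith
    · rw [Set.indicator_of_notMem (show i ∉ {i | δ ≤ l i} from h), zero_sub, abs_neg,
        abs_of_nonneg hi]
      push Not at h
      have h2 : l i ≤ (1 - δ)⁻¹ * (l i * (1 - l i)) := by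
        rw [inv_mul_eq_div, le_div_iff₀ hδ']
        nlinarith
      have h3 : 0 ≤ δ⁻¹ * (l i * (1 - l i)) := by positivity
      linarith
  rw [← hdiff.tsum_eq, ← tsum_mul_left, ← Real.norm_eq_abs]
  exact tsum_of_norm_bounded (hsum2.mul_left _).hasSum hbd

theorem eigenvalueCount_bound {d : ℕ} (c : ℝ) {δ : ℝ} (hδ₀ : 0 < δ) (hδ₁ : δ < 1) :
    eigenvalueCount d c δ < Cardinal.aleph0 ∧
    |(Cardinal.toNat (eigenvalueCount d c δ) : ℝ) -
      (volume (Metric.closedBall (0 : E d) 1) *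
        volume (Metric.closedBall (0 : E d) ((2 * Real.pi)⁻¹ * c))).toReal| ≤
      (δ⁻¹ + (1 - δ)⁻¹) * (leakage d ((2 * Real.pi)⁻¹ * c)).toReal := by
  obtain ⟨w, e, b, hb⟩ := exists_hilbertBasis_eigenspace (Q d c) (isCompactOperator_Q d c)
    (isSymmetric_Q d c)
  set l : (Σ μ, w μ) → ℝ := fun i => ‖bandTime d c (b i)‖ ^ 2 with hl
  have hnorm : ∀ i, ‖b i‖ = 1 := b.orthonormal.1
  have hμ : ∀ i, i.1 = (l i : ℂ) := fun i => by
    have h := inner_Q c (b i) (b i)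
    rw [hb, inner_smul_right, inner_self_eq_norm_sq_to_K, inner_self_eq_norm_sq_to_K,
      hnorm] at h
    simpa [hl] using h
  have hl0 : ∀ i, 0 ≤ l i := fun i => by positivity
  -- The part of `‖T b_i‖²` inside the ball is `‖Q_c b_i‖² = λ_i²`, so the part outside is `λ_i (1 -
  -- λ_i)`.
  have hsplit : ∀ i, ENNReal.ofReal (l i ^ 2) +
      ∫⁻ x in (Metric.closedBall (0 : E d) 1)ᶜ, ‖bandTime d c (b i) x‖ₑ ^ 2
      = ENNReal.ofReal (l i) := fun i => by
    have h1 : ‖Q d c (b i)‖ = l i := by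
      rw [hb, norm_smul, hnorm, mul_one, hμ, Complex.norm_real, Real.norm_eq_abs,
        abs_of_nonneg (hl0 i)]
    have h2 : ENNReal.ofReal (l i ^ 2) = ‖Q d c (b i)‖ₑ ^ 2 := by rw [← h1, ofReal_norm_sq]
    rw [h2, Q_apply, enorm_ballCutoff_sq,
      lintegral_add_compl _ Metric.isClosed_closedBall.measurableSet, ← enorm_sq_eq_lintegral]
    exact (ofReal_norm_sq _).symm
  have hl1 : ∀ i, l i ≤ 1 := fun i => by
    have h2 : l i ^ 2 ≤ l i :=
      (ENNReal.ofReal_le_ofReal_iff (hl0 i)).1 (le_self_add.trans_eq (hsplit i))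
    nlinarith [hl0 i]
  have hleak : ∀ i, ENNReal.ofReal (l i * (1 - l i))
      = ∫⁻ x in (Metric.closedBall (0 : E d) 1)ᶜ, ‖bandTime d c (b i) x‖ₑ ^ 2 := fun i => by
    have h2 : ENNReal.ofReal (l i ^ 2) + ENNReal.ofReal (l i * (1 - l i))
        = ENNReal.ofReal (l i) := by
      rw [← ENNReal.ofReal_add (by positivity) (mul_nonneg (hl0 i) (by linarith [hl1 i]))]
      ring_nf
    exact (ENNReal.add_right_inj ENNReal.ofReal_ne_top).1 (h2.trans (hsplit i).symm)
  have htr : ∑' i, ENNReal.ofReal (l i) = volume (Metric.closedBall (0 : E d) 1) *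
      volume (Metric.closedBall (0 : E d) ((2 * Real.pi)⁻¹ * c)) := by
    simp_rw [hl, ofReal_norm_sq]
    exact tsum_enorm_bandTime_sq b c
  have htr' : ∑' i, ENNReal.ofReal (l i * (1 - l i)) = leakage d ((2 * Real.pi)⁻¹ * c) := by
    simp_rw [hleak]
    exact tsum_lintegral_bandTime b c _
  have hs : Summable l := by
    have hfin : ∑' i, ENNReal.ofReal (l i) ≠ ∞ := by
      rw [htr]
      exact ENNReal.mul_ne_top measure_closedBall_lt_top.ne measure_closedBall_lt_top.ne
    refine (ENNReal.summable_toReal hfin).congr fun i => ?_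
    rw [ENNReal.toReal_ofReal (hl0 i)]
  have hreal : ∀ g : (Σ μ, w μ) → ℝ, (∀ i, 0 ≤ g i) →
      (∑' i, ENNReal.ofReal (g i)).toReal = ∑' i, g i := fun g hg => by
    rw [ENNReal.tsum_toReal_eq fun i => ENNReal.ofReal_ne_top]
    exact tsum_congr fun i => ENNReal.toReal_ofReal (hg i)
  obtain ⟨hfin, hbound⟩ := abs_ncard_sub_tsum_le hl0 hl1 hs hδ₀ hδ₁
  -- Every eigenvalue carried by the basis is real by `hμ`, so basis vectors with `δ ≤ λ_i` are
  -- exactly those from the eigenspaces counted; these are finite-dimensional because `μ ≥ δ > 0`.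
  have hcount : eigenvalueCount d c δ = ({i | δ ≤ l i}.ncard : Cardinal) := by
    have hrank : ∀ μ : Set.Ici δ,
        Module.rank ℂ (Module.End.eigenspace (Q d c : L2 d →ₗ[ℂ] L2 d) ((μ : ℝ) : ℂ))
          = Cardinal.mk (w ((μ : ℝ) : ℂ)) := fun μ => by
      have hne : ((μ : ℝ) : ℂ) ≠ 0 :=
        Complex.ofReal_ne_zero.2 (hδ₀.trans_le (Set.mem_Ici.1 μ.2)).ne'
      have := ContinuousLinearMap.finite_dimensional_eigenspace (isCompactOperator_Q d c) _ hne
      exact rank_eq_mk_of_hilbertBasis (e _)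
    rw [eigenvalueCount]
    simp_rw [hrank]
    rw [← Cardinal.mk_sigma, Set.cast_ncard hfin]
    let φ : (Σ μ : Set.Ici δ, w ((μ : ℝ) : ℂ)) → Σ μ, w μ :=
      Sigma.map (fun μ : Set.Ici δ => ((μ : ℝ) : ℂ)) fun _ => id
    have hφ : Function.Injective φ := Function.Injective.sigma_map
      (fun μ ν h => Subtype.ext (Complex.ofReal_injective h)) fun _ => Function.injective_id
    have hrange : Set.range φ = {i | δ ≤ l i} := by
      ext i
      constructor
      · rintro ⟨⟨μ, x⟩, rfl⟩
        have h : ((μ : ℝ) : ℂ) = (l (φ ⟨μ, x⟩) : ℂ) := hμ (φ ⟨μ, x⟩)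
        change δ ≤ l (φ ⟨μ, x⟩)
        rw [← Complex.ofReal_injective h]
        exact μ.2
      · intro hi
        have h := hμ i
        have hi' : δ ≤ l i := hi
        -- `l i` depends on `i`; a free `r` lets `subst` identify the eigenvalue.
        generalize l i = r at h hi'
        obtain ⟨μ, x⟩ := i
        dsimp only at h
        subst h
        exact ⟨⟨⟨r, hi'⟩, x⟩, rfl⟩
    rw [← hrange]
    exact Cardinal.mk_congr (Equiv.ofInjective φ hφ)
  refine ⟨hcount ▸ Cardinal.natCast_lt_aleph0, ?_⟩
  rw [hcount, Cardinal.toNat_natCast, ← htr, ← htr', hreal l hl0,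
    hreal _ fun i => mul_nonneg (hl0 i) (by linarith [hl1 i])]
  exact hbound

/-- Each unit ball contributes `π^(d/2) / Γ(d/2 + 1)`; the resulting `π^d` cancels against
`(2π)^(-d)`, leaving `2^(-d)`. -/
theorem volume_mul_volume_toReal {d : ℕ} (hd : 1 ≤ d) {c : ℝ} (hc : 0 < c) :
    (volume (Metric.closedBall (0 : E d) 1) *
      volume (Metric.closedBall (0 : E d) ((2 * Real.pi)⁻¹ * c))).toReal
      = c ^ d / (2 ^ d * Real.Gamma ((d : ℝ) / 2 + 1) ^ 2) := by
  have : Nonempty (Fin d) := ⟨⟨0, hd⟩⟩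
  have hpi := Real.pi_pos
  have hG : 0 < Real.Gamma ((d : ℝ) / 2 + 1) := Real.Gamma_pos_of_pos (by positivity)
  rw [EuclideanSpace.volume_closedBall, EuclideanSpace.volume_closedBall, Fintype.card_fin]
  simp only [ENNReal.toReal_mul, ENNReal.toReal_pow]
  rw [ENNReal.toReal_ofReal (by positivity), ENNReal.toReal_ofReal (by positivity),
    ENNReal.toReal_ofReal (by positivity), one_pow, one_mul, mul_pow, inv_pow, mul_pow]
  have hsq : Real.sqrt Real.pi ^ d * Real.sqrt Real.pi ^ d = Real.pi ^ d := by
    rw [← mul_pow, Real.mul_self_sqrt hpi.le]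
  field_simp
  rw [sq, hsq]

end BallProlate

end

/-! ### The asymptotic formula -/

theorem mainTheorem4 (d : ℕ) (hd : 1 ≤ d) (δ : ℝ) (hδ₀ : 0 < δ) (hδ₁ : δ < 1) :
    (∀ c : ℝ, 0 < c → BallProlate.eigenvalueCount d c δ < Cardinal.aleph0) ∧
    (fun c : ℝ => (Cardinal.toNat (BallProlate.eigenvalueCount d c δ) : ℝ) -
        c ^ d / (2 ^ d * Real.Gamma ((d : ℝ) / 2 + 1) ^ 2))
      =o[atTop] fun c : ℝ => c ^ d := by
  refine ⟨fun c _ => (BallProlate.eigenvalueCount_bound c hδ₀ hδ₁).1, ?_⟩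
  have hpi : (0 : ℝ) < (2 * Real.pi)⁻¹ := inv_pos.2 Real.two_pi_pos
  have hO : (fun c : ℝ => (Cardinal.toNat (BallProlate.eigenvalueCount d c δ) : ℝ) -
      c ^ d / (2 ^ d * Real.Gamma ((d : ℝ) / 2 + 1) ^ 2)) =O[atTop]
      fun c => (BallProlate.leakage d ((2 * Real.pi)⁻¹ * c)).toReal := by
    refine IsBigO.of_bound (δ⁻¹ + (1 - δ)⁻¹) ?_
    filter_upwards [eventually_gt_atTop 0] with c hc
    rw [← BallProlate.volume_mul_volume_toReal hd hc, Real.norm_eq_abs, Real.norm_eq_abs,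
      abs_of_nonneg ENNReal.toReal_nonneg]
    exact (BallProlate.eigenvalueCount_bound c hδ₀ hδ₁).2
  have ho : (fun R : ℝ => (BallProlate.leakage d R).toReal) =o[atTop] fun R : ℝ => R ^ d := by
    refine (isLittleO_iff_tendsto' ?_).2 ?_
    · filter_upwards [eventually_gt_atTop 0] with R hR h
      exact absurd h (pow_pos hR d).ne'
    · have h := (ENNReal.tendsto_toReal ENNReal.zero_ne_top).comp
        (BallProlate.tendsto_leakage_div (d := d))
      rw [ENNReal.toReal_zero] at h
      refine h.congr' ?_
      filter_upwards [eventually_gt_atTop 0] with R hR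
      rw [Function.comp_apply, ENNReal.toReal_div, ENNReal.toReal_ofReal (pow_pos hR d).le]
  refine hO.trans_isLittleO ?_
  -- Substitute `R = c / (2π)`; the constant factor `(2π)^(-d)` is harmless.
  have h1 := ho.comp_tendsto (tendsto_id.const_mul_atTop hpi)
  refine h1.trans_isBigO ?_
  simp only [Function.comp_def, mul_pow, id]
  exact isBigO_const_mul_self _ _ _
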